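/- Let $(\Omega,\mathcal A,\mu)$ be a complete $\sigma$-finite measure space with $\mu(\Omega)>0$, and let $M\colon\Omega\rightrightarrows\mathbb R^n$ be a measurable multifunction with closed values, i.e. every $M(\omega)$ is closed and $\{\omega\in\Omega\mid M(\omega)\cap U\neq\emptyset\}\in\mathcal A$ for every open $U\subset\mathbb R^n$. Its essential intersection is $$M_\cap:=\{x\in\mathbb R^n\mid x\in M(\omega)\text{ for almost all }\omega\in\Omega\}.$$ *Notation.* For $\Theta\subset\mathbb R^m$ and $\bar x\in\Theta$, the regular normal cone $\hat N(\bar x;\Theta)$ is the set of all $x^*\in\mathbb R^m$ with $\limsup_{x\to\bar x,\,x\in\Theta\setminus\{\bar x\}}\langle x^*,x-\bar x\rangle/\|x-\bar x\|\le 0$ (all of $\mathbb R^m$ if $\bar x$ is isolated in $\Theta$). The limiting normal cone $N(\bar x;\Theta)$ is the set of all limits $\lim_k x_k^*$ of convergent sequences with $x_k^*\in\hat N(x_k;\Theta)$, $x_k\in\Theta$, $x_k\to\bar x$. The set $\Theta$ is normally regular at $\bar x$ if $\hat N(\bar x;\Theta)=N(\bar x;\Theta)$. The contingent cone $T(\bar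 x;\Theta)$ is the set of all $v=\lim_k v_k$ such that $\bar x+\tau_kv_k\in\Theta$ for some $\tau_k>0$ with $\tau_k\to0$. The measurable CHIP holds for $M$ at $\bar x\in M_\cap$ if $$T(\bar x;M_\cap)=\{v\in\mathbb R^n\mid v\in T(\bar x;M(\omega))\text{ for almost all }\omega\in\Omega\}.$$ A set $\Theta$ is a cone if $\lambda x\in\Theta$ for all $x\in\Theta$ and $\lambda>0$. For $h\colon\mathbb R^n\to(-\infty,\infty]$ with $h(\bar x)<\infty$ and $\mathrm{epi}\,h:=\{(x,\alpha)\in\mathbb R^n\times\mathbb R\mid\alpha\ge h(x)\}$ put $$\partial h(\bar x):=\{x^*\mid(x^*,-1)\in N((\bar x,h(\bar x));\mathrm{epi}\,h)\},\qquad \partial^\infty h(\bar x):=\{x^*\mid(x^*,0)\in N((\bar x,h(\bar x));\mathrm{epi}\,h)\}.$$ Finally, $\int_\Omega N(\bar x;M(\omega))\,d\mu(\omega)$ denotes the Aumann integral, i.e. the set of all $\int_\Omega x^*(\omega)\,d\mu(\omega)$ with $x^*\in L^1(\Omega,\mathbb R^n)$ and $x^*(\omega)\in N(\bar x;M(\omega))$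 for almost all $\omega$, and $\mathrm{cl}$ is the closure. **Theorem.** Let $h\colon\mathbb R^n\to(-\infty,\infty]$ be lower semicontinuous at all points of some neighborhood of $\bar x$, where $\bar x\in M_\cap$, $h(\bar x)<\infty$, and $\bar x$ is a local minimizer of $h$ over $M_\cap$. Consider the qualification condition $$\big(-\partial^\infty h(\bar x)\big)\cap\mathrm{cl}\Big(\int_\Omega N(\bar x;M(\omega))\,d\mu(\omega)\Big)=\{0\}\tag{Q}$$ and the optimality condition $$0\in\partial h(\bar x)+\mathrm{cl}\Big(\int_\Omega N(\bar x;M(\omega))\,d\mu(\omega)\Big).\tag{O}$$ (i) If $M_\cap$ is normally regular at $\bar x$, the measurable CHIP holds for $M$ at $\bar x$, and (Q) is satisfied, then (O) holds. (ii) If the sets $M(\omega)$ are cones for almost all $\omega\in\Omega$, $\bar x=0$, and (Q) is satisfied, then (O) holds. -/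

import Mathlib

open Filter MeasureTheory Topology
open scoped RealInnerProductSpace Pointwise

namespace VarAn

section Cones

variable {E : Type*} [NormedAddCommGroup E] [InnerProductSpace ℝ E]

/-- The (Fréchet) regular normal cone to `S` at `x ∈ S`: all `v` such that
`limsup ⟪v, y - x⟫ / ‖y - x‖ ≤ 0` as `y → x` with `y ∈ S`, `y ≠ x`.
The upper limit is written out with `ε`; at `y = x` the inequality is trivial.
The cone is empty if `x ∉ S`. -/
def regularNormalCone (x : E) (S : Set E) : Set E :=
  {v | x ∈ S ∧ ∀ ε : ℝ, 0 < ε → ∀ᶠ y in 𝓝[S] x, ⟪v, y - x⟫ ≤ ε * ‖y - x‖}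

/-- The (Mordukhovich) limiting normal cone to `S` at `x ∈ S`: the outer limit of the regular
normal cones at `y` as `y → x` with `y ∈ S`. The cone is empty if `x ∉ S`. -/
def limitingNormalCone (x : E) (S : Set E) : Set E :=
  {v | x ∈ S ∧ ∃ (y : ℕ → E) (w : ℕ → E), (∀ k, y k ∈ S) ∧ Tendsto y atTop (𝓝 x) ∧
    (∀ k, w k ∈ regularNormalCone (y k) S) ∧ Tendsto w atTop (𝓝 v)}

/-- The (Bouligand-Severi) contingent cone to `S` at `x`: the outer limit of `(S - x) / τ`
as `τ ↓ 0`. -/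
def contingentCone (x : E) (S : Set E) : Set E :=
  {v | ∃ (τ : ℕ → ℝ) (w : ℕ → E), (∀ k, 0 < τ k) ∧ Tendsto τ atTop (𝓝 0) ∧
    Tendsto w atTop (𝓝 v) ∧ ∀ k, x + τ k • w k ∈ S}

/-- `S` is normally regular at `x`. -/
def NormallyRegularAt (S : Set E) (x : E) : Prop :=
  regularNormalCone x S = limitingNormalCone x S

/-- `S` is a (not necessarily convex) cone. -/
def IsConeSet (S : Set E) : Prop :=
  ∀ x ∈ S, ∀ t : ℝ, 0 < t → t • x ∈ S

/-- The epigraph of an extended-real-valued function, in `E × ℝ` with the Euclidean product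
structure. -/
def epi (f : E → EReal) : Set (WithLp 2 (E × ℝ)) :=
  {p | f p.fst ≤ (p.snd : EReal)}

/-- The (Mordukhovich) basic subdifferential of `f` at a point `x` with `f x` finite. -/
def basicSubdifferential (f : E → EReal) (x : E) : Set E :=
  {v | WithLp.toLp 2 (v, (-1 : ℝ)) ∈ limitingNormalCone (WithLp.toLp 2 (x, (f x).toReal)) (epi f)}

/-- The singular subdifferential of `f` at a point `x` with `f x` finite. -/
def singularSubdifferential (f : E → EReal) (x : E) : Set E :=
  {v | WithLp.toLp 2 (v, (0 : ℝ)) ∈ limitingNormalCone (WithLp.toLp 2 (x, (f x).toReal)) (epi f)}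

end Cones

section Multifunctions

variable {Ω : Type*} [MeasurableSpace Ω] {E : Type*}

/-- A set-valued mapping is measurable if the inverse images of open sets are measurable. -/
def MeasurableMultifunction [TopologicalSpace E] (M : Ω → Set E) : Prop :=
  ∀ U : Set E, IsOpen U → MeasurableSet {ω | (M ω ∩ U).Nonempty}

/-- The essential intersection of `M`: all points lying in `M ω` for almost all `ω`. -/
def essInter (μ : Measure Ω) (M : Ω → Set E) : Set E :=
  {x | ∀ᵐ ω ∂μ, x ∈ M ω}

/-- The Aumann integral of `M`: the integrals of all integrable a.e. selections of `M`. -/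
def aumannIntegral [NormedAddCommGroup E] [NormedSpace ℝ E] (μ : Measure Ω) (M : Ω → Set E) :
    Set E :=
  {u | ∃ f : Ω → E, Integrable f μ ∧ (∀ᵐ ω ∂μ, f ω ∈ M ω) ∧ u = ∫ ω, f ω ∂μ}

/-- The measurable CHIP (conical hull intersection property) for `M` at `x`: the contingent cone
to the essential intersection is the essential intersection of the contingent cones. -/
def MeasurableCHIP [NormedAddCommGroup E] [InnerProductSpace ℝ E] (μ : Measure Ω)
    (M : Ω → Set E) (x : E) : Prop :=
  contingentCone x (essInter μ M) = essInter μ (fun ω => contingentCone x (M ω))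

end Multifunctions

end VarAn

/-! Write `C` for the essential intersection, a closed set. Everything reduces to one inclusion:
limiting normals to `C` at `xbar` lie in the closure `K` of the Aumann integral of `N(xbar; M ω)`.
Given this, a local minimizer of `h` over `C` produces a limiting normal `w` to `C` whose opposite
is either a basic subgradient, which is (O), or a nonzero singular subgradient, which (Q) forbids.

The core is a fuzzy intersection rule, `exists_integral_nearest`. With a positive integrable weight
`ρ`, the function `y ↦ ∫ ρ ω * dist(y, M ω)^2` vanishes at points of `C` and, in the region
considered, only there. Exact penalization of the inequality defining a regular normal `v`, followed
by Fermat's rule, shows that `v` is within `ε` of an integral of nonnegative multiples of `y - p ω`,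
with `p ω` a measurable choice of nearest points to `y`.

These proximal normals are based at `p ω`, not at `xbar`. Cones remove the discrepancy: a proximal
normal to a contingent cone, at any of its points, is a limiting normal to the original set at the
base point (`sub_mem_limitingNormalCone_of_nearest`). In (ii) each `M ω` is its own contingent cone
at `0`. In (i) regularity makes every limiting normal regular, hence polar to the contingent cone of
`C`; by CHIP it is then a regular normal at `0` to the essential intersection of the contingent
cones, to which the rule applies. -/

namespace VarAn

/-! ### Exact penalization on a compact set. -/

section Penalty

/-- Exact localisation of penalised minimizers: if `x₀` is the only point of the compact set `B`
with `φ = 0` and `f ≤ 0`, then for a large penalty some minimizer of `f + k φ` is near `x₀`. -/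
theorem exists_isMinOn_add_mul {X : Type*} [TopologicalSpace X] {B U : Set X} {f φ : X → ℝ}
    {x₀ : X} (hB : IsCompact B) (hf : ContinuousOn f B) (hφ : ContinuousOn φ B)
    (hφ0 : ∀ y ∈ B, 0 ≤ φ y) (hx₀ : x₀ ∈ B) (hfx : f x₀ = 0) (hφx : φ x₀ = 0)
    (huniq : ∀ y ∈ B, φ y = 0 → f y ≤ 0 → y = x₀) (hU : U ∈ 𝓝 x₀) :
    ∃ k : ℝ, 0 ≤ k ∧ ∃ y ∈ B, y ∈ U ∧ ∀ z ∈ B, f y + k * φ y ≤ f z + k * φ z := by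
  have hB' : IsCompact (B \ interior U) := hB.diff isOpen_interior
  have key : ∃ k : ℝ, 0 ≤ k ∧ ∀ z ∈ B \ interior U, z ∈ B → 0 < f z + k * φ z := by
    -- Locally some penalty makes `f + k φ` positive. Since `φ ≥ 0`, adding penalties preserves
    -- positivity, so compactness yields one `k` for all of `B \ interior U`. The minimal value is
    -- at most the value `0` at `x₀`, which forces the minimizer into `U`.
    refine hB'.induction_on (p := fun s => ∃ k : ℝ, 0 ≤ k ∧ ∀ z ∈ s, z ∈ B → 0 < f z + k * φ z)
      ⟨0, le_rfl, by simp⟩ ?_ ?_ ?_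
    · rintro s t hst ⟨k, hk, h⟩
      exact ⟨k, hk, fun z hz => h z (hst hz)⟩
    · rintro s t ⟨k, hk, h⟩ ⟨l, hl, h'⟩
      refine ⟨k + l, by positivity, ?_⟩
      rintro z (hz | hz) hzB
      · have := h z hz hzB
        have := mul_nonneg hl (hφ0 z hzB)
        linarith
      · have := h' z hz hzB
        have := mul_nonneg hk (hφ0 z hzB)
        linarith
    · rintro y ⟨hyB, hyU⟩
      have hpos : ∃ k : ℝ, 0 ≤ k ∧ 0 < f y + k * φ y := by
        rcases (hφ0 y hyB).eq_or_lt with h0 | h0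
        · refine ⟨0, le_rfl, ?_⟩
          by_contra hneg
          have : y = x₀ := huniq y hyB h0.symm (by simpa using hneg)
          exact hyU (this ▸ mem_interior_iff_mem_nhds.2 hU)
        · refine ⟨(|f y| + 1) / φ y, by positivity, ?_⟩
          rw [div_mul_cancel₀ _ h0.ne']
          linarith [neg_abs_le (f y)]
      obtain ⟨k, hk, hlt⟩ := hpos
      have hc : ContinuousWithinAt (fun z => f z + k * φ z) B y :=
        (hf y hyB).add (continuousWithinAt_const.mul (hφ y hyB))
      have hev := hc.eventually (lt_mem_nhds hlt)
      refine ⟨{z | z ∈ B → 0 < f z + k * φ z}, ?_, k, hk, fun z hz => hz⟩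
      have := eventually_nhdsWithin_iff.1 hev
      exact mem_nhdsWithin_of_mem_nhds this
  obtain ⟨k, hk, hpos⟩ := key
  obtain ⟨y, hyB, hy⟩ := hB.exists_isMinOn ⟨x₀, hx₀⟩
    (hf.add (continuousOn_const.mul hφ) : ContinuousOn (fun z => f z + k * φ z) B)
  refine ⟨k, hk, y, hyB, ?_, fun z hz => hy hz⟩
  by_contra hyU
  have h1 := hpos y ⟨hyB, fun h => hyU (interior_subset h)⟩ hyB
  have h2 : f y + k * φ y ≤ f x₀ + k * φ x₀ := hy hx₀
  rw [hfx, hφx] at h2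
  linarith

end Penalty

/-! ### Normal cones, contingent cones and nearest points. -/

section Normals

variable {E : Type*} [NormedAddCommGroup E] [InnerProductSpace ℝ E]

theorem mem_regularNormalCone_of_quadratic {x v : E} {S : Set E} {c : ℝ} (hx : x ∈ S)
    (h : ∀ᶠ y in 𝓝[S] x, ⟪v, y - x⟫ ≤ c * ‖y - x‖ ^ 2) : v ∈ regularNormalCone x S := by
  refine ⟨hx, fun ε hε => ?_⟩
  have ht : Tendsto (fun y => c * ‖y - x‖) (𝓝[S] x) (𝓝 0) := by
    have : Continuous fun y => c * ‖y - x‖ := by fun_prop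
    simpa using (this.tendsto x).mono_left nhdsWithin_le_nhds
  filter_upwards [h, ht.eventually (gt_mem_nhds hε)] with y hy hy'
  calc ⟪v, y - x⟫ ≤ (c * ‖y - x‖) * ‖y - x‖ := by rw [mul_assoc, ← sq]; exact hy
    _ ≤ ε * ‖y - x‖ := by gcongr

theorem regularNormalCone_smul {x v : E} {S : Set E} (hv : v ∈ regularNormalCone x S) {c : ℝ}
    (hc : 0 ≤ c) : c • v ∈ regularNormalCone x S := by
  refine ⟨hv.1, fun ε hε => ?_⟩
  filter_upwards [hv.2 (ε / (c + 1)) (by positivity)] with y hy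
  rw [real_inner_smul_left]
  calc c * ⟪v, y - x⟫ ≤ c * (ε / (c + 1) * ‖y - x‖) := by gcongr
    _ = (c / (c + 1)) * (ε * ‖y - x‖) := by ring
    _ ≤ 1 * (ε * ‖y - x‖) := by
        gcongr
        rw [div_le_one (by positivity)]
        linarith
    _ = _ := one_mul _

theorem limitingNormalCone_smul {x v : E} {S : Set E} (hv : v ∈ limitingNormalCone x S) {c : ℝ}
    (hc : 0 ≤ c) : c • v ∈ limitingNormalCone x S := by
  obtain ⟨hx, y, w, hy, hyx, hw, hwv⟩ := hv
  exact ⟨hx, y, fun k => c • w k, hy, hyx, fun k => regularNormalCone_smul (hw k) hc,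
    hwv.const_smul c⟩

theorem sub_mem_regularNormalCone_of_isNearest {z p : E} {S : Set E} (hp : p ∈ S)
    (h : ∀ q ∈ S, ‖z - p‖ ≤ ‖z - q‖) : z - p ∈ regularNormalCone p S := by
  refine mem_regularNormalCone_of_quadratic (c := 1 / 2) hp ?_
  filter_upwards [self_mem_nhdsWithin] with q hq
  have h1 : ‖z - p‖ ^ 2 ≤ ‖z - q‖ ^ 2 := by
    have := h q hq
    gcongr
  have h2 : z - q = (z - p) - (q - p) := by abel
  rw [h2, norm_sub_sq_real (z - p) (q - p)] at h1
  linarith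

theorem mem_contingentCone_iff {x v : E} {S : Set E} :
    v ∈ contingentCone x S ↔
      ∀ ε : ℝ, 0 < ε → ∃ t : ℝ, 0 < t ∧ t < ε ∧ ∃ w, dist w v < ε ∧ x + t • w ∈ S := by
  constructor
  · rintro ⟨τ, w, hτ, hτ0, hw, hS⟩ ε hε
    obtain ⟨k, hk1, hk2⟩ := ((hτ0.eventually (gt_mem_nhds hε)).and
      (hw.eventually (Metric.ball_mem_nhds v hε))).exists
    exact ⟨τ k, hτ k, hk1, w k, hk2, hS k⟩
  · intro h
    choose τ hτ hτ' w hw hS using fun k : ℕ => h (1 / ((k : ℝ) + 1)) (by positivity)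
    refine ⟨τ, w, hτ, ?_, ?_, hS⟩
    · exact squeeze_zero (fun k => (hτ k).le) (fun k => (hτ' k).le)
        tendsto_one_div_add_atTop_nhds_zero_nat
    · rw [tendsto_iff_dist_tendsto_zero]
      exact squeeze_zero (fun k => dist_nonneg) (fun k => (hw k).le)
        tendsto_one_div_add_atTop_nhds_zero_nat

theorem isClosed_contingentCone (x : E) (S : Set E) : IsClosed (contingentCone x S) := by
  refine isClosed_of_closure_subset fun v hv => mem_contingentCone_iff.2 fun ε hε => ?_
  obtain ⟨u, hu, huv⟩ := Metric.mem_closure_iff.1 hv (ε / 2) (by positivity)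
  obtain ⟨t, ht, htε, w, hw, hS⟩ := mem_contingentCone_iff.1 hu (ε / 2) (by positivity)
  refine ⟨t, ht, by linarith, w, ?_, hS⟩
  have := dist_triangle w u v
  rw [dist_comm v u] at huv
  linarith

theorem zero_mem_contingentCone {x : E} {S : Set E} (hx : x ∈ S) :
    (0 : E) ∈ contingentCone x S :=
  mem_contingentCone_iff.2 fun ε hε => ⟨ε / 2, by positivity, by linarith, 0, by simpa, by simpa⟩

theorem contingentCone_zero_of_isConeSet {S : Set E} (hS : IsClosed S) (hc : IsConeSet S) :
    contingentCone 0 S = S := by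
  ext v
  constructor
  · rintro ⟨τ, w, hτ, -, hw, hmem⟩
    refine hS.mem_of_tendsto hw (Eventually.of_forall fun k => ?_)
    have := hc _ (hmem k) (τ k)⁻¹ (inv_pos.2 (hτ k))
    rwa [zero_add, smul_smul, inv_mul_cancel₀ (hτ k).ne', one_smul] at this
  · intro hv
    exact mem_contingentCone_iff.2 fun ε hε => ⟨ε / 2, by positivity, by linarith, v,
      by simpa, by simpa using hc v hv _ (half_pos hε)⟩

/-- Regular normals are polar to the contingent cone. -/
theorem inner_nonpos_of_mem_contingentCone {x u v : E} {S : Set E}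
    (hv : v ∈ regularNormalCone x S) (hu : u ∈ contingentCone x S) : ⟪v, u⟫ ≤ 0 := by
  obtain ⟨τ, w, hτ, hτ0, hw, hS⟩ := hu
  have hlim : Tendsto (fun k => x + τ k • w k) atTop (𝓝[S] x) := by
    refine tendsto_nhdsWithin_iff.2 ⟨?_, Eventually.of_forall hS⟩
    simpa using tendsto_const_nhds.add (hτ0.smul hw)
  have hle : ∀ ε : ℝ, 0 < ε → ⟪v, u⟫ ≤ ε * ‖u‖ := by
    intro ε hε
    refine le_of_tendsto_of_tendsto (tendsto_const_nhds.inner hw) (hw.norm.const_mul ε) ?_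
    filter_upwards [hlim.eventually (hv.2 ε hε)] with k hk
    rw [add_sub_cancel_left, real_inner_smul_right, norm_smul, Real.norm_of_nonneg (hτ k).le] at hk
    refine le_of_mul_le_mul_left ?_ (hτ k)
    linarith
  have ht : Tendsto (fun ε : ℝ => ε * ‖u‖) (𝓝[>] 0) (𝓝 0) := by
    have : Continuous fun ε : ℝ => ε * ‖u‖ := by fun_prop
    simpa using (this.tendsto 0).mono_left nhdsWithin_le_nhds
  exact ge_of_tendsto ht (by filter_upwards [self_mem_nhdsWithin] with ε hε using hle ε hε)

/-- Project `x + τ k • z` onto `S` and rescale by `1 / τ k`. The rescaled projections `q k` are no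
farther from `z` than the `w k` that tend to `p`, so they cluster at a point of the contingent cone,
which uniqueness identifies as `p`. The vectors `z - q k` are proximal normals to `S` at points
tending to `x`. -/
theorem sub_mem_limitingNormalCone_of_unique_nearest [ProperSpace E] {x z p : E} {S : Set E}
    (hS : IsClosed S) (hx : x ∈ S) (hp : p ∈ contingentCone x S)
    (h : ∀ q ∈ contingentCone x S, ‖z - q‖ ≤ ‖z - p‖ → q = p) :
    z - p ∈ limitingNormalCone x S := by
  obtain ⟨τ, w, hτ, hτ0, hw, hmem⟩ := hp
  have hproj : ∀ k, ∃ π ∈ S, Metric.infDist (x + τ k • z) S = dist (x + τ k • z) π :=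
    fun k => hS.exists_infDist_eq_dist ⟨x, hx⟩ _
  choose π hπS hπ using hproj
  let q : ℕ → E := fun k => (τ k)⁻¹ • (π k - x)
  have hq : ∀ k, π k = x + τ k • q k := fun k => by
    simp [q, smul_smul, mul_inv_cancel₀ (hτ k).ne']
  have hnear : ∀ k, ∀ s ∈ S, ‖(x + τ k • z) - π k‖ ≤ ‖(x + τ k • z) - s‖ := fun k s hs => by
    rw [← dist_eq_norm, ← dist_eq_norm, ← hπ k]
    exact Metric.infDist_le_dist_of_mem hs
  have hdiff : ∀ k (a : E), (x + τ k • z) - (x + τ k • a) = τ k • (z - a) := fun k a => by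
    rw [add_sub_add_left_eq_sub, smul_sub]
  have hle : ∀ k, ‖z - q k‖ ≤ ‖z - w k‖ := fun k => by
    have := hnear k _ (hmem k)
    rw [hq k, hdiff, hdiff, norm_smul, norm_smul] at this
    exact le_of_mul_le_mul_left this (norm_pos_iff.2 (hτ k).ne')
  have hzw : Tendsto (fun k => ‖z - w k‖) atTop (𝓝 ‖z - p‖) := (tendsto_const_nhds.sub hw).norm
  obtain ⟨R, hR⟩ := hzw.bddAbove_range
  have hqb : ∀ k, q k ∈ Metric.closedBall z R := fun k => by
    rw [mem_closedBall_iff_norm, norm_sub_rev]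
    exact (hle k).trans (hR ⟨k, rfl⟩)
  obtain ⟨a, -, φ, hφ, ha⟩ := (isCompact_closedBall z R).tendsto_subseq hqb
  have hτφ := hτ0.comp hφ.tendsto_atTop
  have haT : a ∈ contingentCone x S :=
    ⟨τ ∘ φ, q ∘ φ, fun k => hτ _, hτφ, ha, fun k => by
      have := hπS (φ k)
      rwa [hq] at this⟩
  have hap : a = p := h a haT (le_of_tendsto_of_tendsto' (tendsto_const_nhds.sub ha).norm
    (hzw.comp hφ.tendsto_atTop) fun k => hle (φ k))
  subst hap
  refine ⟨hx, fun k => π (φ k), fun k => z - q (φ k), fun k => hπS _, ?_, fun k => ?_,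
    tendsto_const_nhds.sub ha⟩
  · have : Tendsto (fun k => x + τ (φ k) • q (φ k)) atTop (𝓝 (x + (0 : ℝ) • a)) :=
      tendsto_const_nhds.add (hτφ.smul ha)
    simpa [← hq] using this
  · have h1 := regularNormalCone_smul
      (sub_mem_regularNormalCone_of_isNearest (hπS (φ k)) (hnear (φ k)))
      (inv_nonneg.2 (hτ (φ k)).le)
    have h2 : z - q (φ k) = (τ (φ k))⁻¹ • ((x + τ (φ k) • z) - π (φ k)) := by
      conv_rhs => rw [hq, hdiff, smul_smul, inv_mul_cancel₀ (hτ _).ne', one_smul]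
    change z - q (φ k) ∈ _
    rw [h2]
    exact h1

/-- Proximal normals to the contingent cone are limiting normals to the set. -/
theorem sub_mem_limitingNormalCone_of_nearest [ProperSpace E] {x z p : E} {S : Set E}
    (hS : IsClosed S) (hx : x ∈ S) (hp : p ∈ contingentCone x S)
    (h : ∀ q ∈ contingentCone x S, ‖z - p‖ ≤ ‖z - q‖) :
    z - p ∈ limitingNormalCone x S := by
  -- Moving `z` halfway towards `p` makes the nearest point unique; scaling the normal by `2` then
  -- recovers `z - p`.
  have key : (p + (1 / 2 : ℝ) • (z - p)) - p ∈ limitingNormalCone x S := by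
    refine sub_mem_limitingNormalCone_of_unique_nearest hS hx hp fun q hq hle => ?_
    have h1 : ‖z - p‖ ^ 2 ≤ ‖(z - p) - (q - p)‖ ^ 2 := by
      have := h q hq
      rw [sub_sub_sub_cancel_right]
      gcongr
    have h2 : ‖(1 / 2 : ℝ) • (z - p) - (q - p)‖ ^ 2 ≤ ‖(1 / 2 : ℝ) • (z - p)‖ ^ 2 := by
      have e1 : p + (1 / 2 : ℝ) • (z - p) - q = (1 / 2 : ℝ) • (z - p) - (q - p) := by abel
      rw [e1, add_sub_cancel_left] at hle
      gcongr
    rw [norm_sub_sq_real _ (q - p)] at h1 h2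
    rw [real_inner_smul_left] at h2
    have h3 : ‖q - p‖ ^ 2 ≤ 0 := by linarith
    have h4 : ‖q - p‖ = 0 := by
      have := sq_nonneg ‖q - p‖
      exact pow_eq_zero_iff two_ne_zero |>.1 (le_antisymm h3 this)
    exact sub_eq_zero.1 (norm_eq_zero.1 h4)
  have := limitingNormalCone_smul key (c := 2) (by norm_num)
  rwa [add_sub_cancel_left, smul_smul, mul_one_div_cancel two_ne_zero, one_smul] at this

/-- Test with `y = x + t • a` and let `t ↓ 0`. The alternative `a = 0` is needed because `ε` may be
negative. -/
theorem norm_le_of_eventually_inner_le {a x : E} {ε c : ℝ}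
    (h : ∀ᶠ y in 𝓝 x, ⟪a, y - x⟫ ≤ ε * ‖y - x‖ + c * ‖y - x‖ ^ 2) : ‖a‖ ≤ ε ∨ a = 0 := by
  by_cases ha : a = 0
  · exact Or.inr ha
  left
  have hna : 0 < ‖a‖ := norm_pos_iff.2 ha
  have hlim : Tendsto (fun t : ℝ => x + t • a) (𝓝[>] 0) (𝓝 x) := by
    have : Continuous fun t : ℝ => x + t • a := by fun_prop
    simpa using (this.tendsto 0).mono_left nhdsWithin_le_nhds
  have ht : Tendsto (fun t : ℝ => ε + c * (t * ‖a‖)) (𝓝[>] 0) (𝓝 ε) := by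
    have : Continuous fun t : ℝ => ε + c * (t * ‖a‖) := by fun_prop
    simpa using (this.tendsto 0).mono_left nhdsWithin_le_nhds
  refine ge_of_tendsto ht ?_
  filter_upwards [hlim.eventually h, self_mem_nhdsWithin] with t hy ht
  have ht : 0 < t := ht
  rw [add_sub_cancel_left, real_inner_smul_right, norm_smul, Real.norm_of_nonneg ht.le,
    real_inner_self_eq_norm_sq] at hy
  refine le_of_mul_le_mul_left ?_ (mul_pos ht hna)
  nlinarith

end Normals

/-! ### Measurable multifunctions and selections of nearest points. -/

section Measurability

variable {Ω : Type*} [MeasurableSpace Ω]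

/-- Open sets are countable unions of compact sets. Testing on compact sets allows limits to be
extracted in the arguments below. -/
theorem measurableMultifunction_of_isCompact {E : Type*} [MetricSpace E] [ProperSpace E]
    {M : Ω → Set E}
    (h : ∀ C : Set E, IsCompact C → MeasurableSet {ω | (M ω ∩ C).Nonempty}) :
    MeasurableMultifunction M := by
  intro U hU
  obtain ⟨F, hF, -, hFU, -⟩ := hU.exists_iUnion_isClosed
  have : {ω | (M ω ∩ U).Nonempty} =
      ⋃ n, ⋃ m, {ω | (M ω ∩ (F n ∩ compactCovering E m)).Nonempty} := by
    ext ω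
    simp only [Set.mem_ofPred_eq, Set.mem_iUnion, ← hFU]
    constructor
    · rintro ⟨x, hx, hxU⟩
      obtain ⟨n, hn⟩ := Set.mem_iUnion.1 hxU
      exact ⟨n, (exists_mem_compactCovering x).choose, x, hx, hn,
        (exists_mem_compactCovering x).choose_spec⟩
    · rintro ⟨n, m, x, hx, hn, -⟩
      exact ⟨x, hx, Set.mem_iUnion.2 ⟨n, hn⟩⟩
  rw [this]
  exact .iUnion fun n => .iUnion fun m =>
    h _ ((isCompact_compactCovering E m).inter_left (hF n))

theorem MeasurableMultifunction.measurable_infDist {E : Type*} [MetricSpace E] {M : Ω → Set E}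
    (hM : MeasurableMultifunction M) (hne : ∀ ω, (M ω).Nonempty) (e : E) :
    Measurable fun ω => Metric.infDist e (M ω) := by
  refine measurable_of_Iio fun r => ?_
  convert hM (Metric.ball e r) Metric.isOpen_ball using 1
  ext ω
  simp only [Set.mem_preimage, Set.mem_Iio, Metric.infDist_lt_iff (hne ω), Set.mem_ofPred_eq,
    Set.Nonempty, Set.mem_inter_iff, Metric.mem_ball, dist_comm e]

theorem tendsto_of_dist_lt_one_div {X : Type*} [PseudoMetricSpace X] {u : ℕ → X} {l : X}
    (hu : ∀ j : ℕ, dist (u j) l < 1 / ((j : ℝ) + 1)) : Tendsto u atTop (𝓝 l) :=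
  tendsto_iff_dist_tendsto_zero.2 (squeeze_zero (fun _ => dist_nonneg) (fun j => (hu j).le)
    tendsto_one_div_add_atTop_nhds_zero_nat)

theorem exists_tendsto_subseq_of_dist_lt {E : Type*} [MetricSpace E] {C : Set E}
    (hC : IsCompact C) {u : ℕ → E}
    (hu : ∀ m : ℕ, u m ∈ Metric.thickening (1 / ((m : ℝ) + 1)) C) :
    ∃ c ∈ C, ∃ φ : ℕ → ℕ, StrictMono φ ∧ Tendsto (u ∘ φ) atTop (𝓝 c) := by
  choose c hc hd using fun m => Metric.mem_thickening_iff.1 (hu m)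
  obtain ⟨a, ha, φ, hφ, hlim⟩ := hC.tendsto_subseq hc
  refine ⟨a, ha, φ, hφ, hlim.congr_dist ?_⟩
  refine squeeze_zero (fun _ => dist_nonneg) (fun k => ?_)
    (tendsto_one_div_add_atTop_nhds_zero_nat.comp hφ.tendsto_atTop)
  rw [dist_comm]
  exact (hd (φ k)).le

/-- Hitting a compact `C` within the closed ball amounts to hitting, for every `m`, the
`1/(m+1)`-thickening of `C` inside an open ball of rational radius below `r ω + 1/(m+1)`. Rational
radii keep the union countable although `r` varies with `ω`. -/
theorem MeasurableMultifunction.inter_closedBall {E : Type*} [MetricSpace E] [ProperSpace E]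
    {M : Ω → Set E} (hM : MeasurableMultifunction M) (hc : ∀ ω, IsClosed (M ω)) (e : E)
    {r : Ω → ℝ} (hr : Measurable r) :
    MeasurableMultifunction fun ω => M ω ∩ Metric.closedBall e (r ω) := by
  refine measurableMultifunction_of_isCompact fun C hC => ?_
  have : {ω | ((M ω ∩ Metric.closedBall e (r ω)) ∩ C).Nonempty} =
      ⋂ m : ℕ, ⋃ q : ℚ, {ω | (q : ℝ) < r ω + 1 / ((m : ℝ) + 1)} ∩
        {ω | (M ω ∩ (Metric.ball e q ∩ Metric.thickening (1 / ((m : ℝ) + 1)) C)).Nonempty} := by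
    ext ω
    simp only [Set.mem_ofPred_eq, Set.mem_iInter, Set.mem_iUnion, Set.mem_inter_iff]
    constructor
    · rintro ⟨x, ⟨hx, hxr⟩, hxC⟩ m
      have hm : (0 : ℝ) < 1 / ((m : ℝ) + 1) := by positivity
      obtain ⟨q, hq1, hq2⟩ := exists_rat_btwn
        (lt_of_le_of_lt (Metric.mem_closedBall.1 hxr) (lt_add_of_pos_right (r ω) hm))
      exact ⟨q, hq2, x, hx, hq1, Metric.self_subset_thickening hm C hxC⟩
    · intro h
      choose q hq u hu hball hthick using h
      obtain ⟨c, hcC, φ, hφ, hlim⟩ := exists_tendsto_subseq_of_dist_lt hC hthick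
      refine ⟨c, ⟨(hc ω).mem_of_tendsto hlim (Eventually.of_forall fun k => hu _), ?_⟩, hcC⟩
      have h1 : Tendsto (fun k => r ω + 1 / ((φ k : ℝ) + 1)) atTop (𝓝 (r ω + 0)) :=
        tendsto_const_nhds.add
          (tendsto_one_div_add_atTop_nhds_zero_nat.comp hφ.tendsto_atTop)
      rw [add_zero] at h1
      exact le_of_tendsto_of_tendsto' (hlim.dist tendsto_const_nhds) h1
        fun k => ((Metric.mem_ball.1 (hball (φ k))).trans (hq (φ k))).le
  rw [this]
  exact .iInter fun m => .iUnion fun q => (measurableSet_lt measurable_const (by fun_prop)).inter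
    (hM _ (Metric.isOpen_ball.inter Metric.isOpen_thickening))

/-- Lexicographic minimization: first keep the points nearest to `e`, then among them those nearest
to each listed point in turn. Every distance to a listed point thus becomes constant on `N ω`. -/
theorem MeasurableMultifunction.exists_subset_nearest {E : Type*} [MetricSpace E] [ProperSpace E]
    {M : Ω → Set E} (hM : MeasurableMultifunction M) (hc : ∀ ω, IsClosed (M ω))
    (hne : ∀ ω, (M ω).Nonempty) (e : E) (L : List E) :
    ∃ N : Ω → Set E, MeasurableMultifunction N ∧ (∀ ω, IsClosed (N ω)) ∧
      (∀ ω, (N ω).Nonempty) ∧ (∀ ω, ∀ p ∈ N ω, p ∈ M ω ∧ dist p e = Metric.infDist e (M ω)) ∧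
      ∀ a ∈ L, ∃ r : Ω → ℝ, Measurable r ∧ ∀ ω, ∀ p ∈ N ω, dist p a = r ω := by
  have step : ∀ M : Ω → Set E, MeasurableMultifunction M → (∀ ω, IsClosed (M ω)) →
      (∀ ω, (M ω).Nonempty) → ∀ e : E, ∃ N : Ω → Set E, MeasurableMultifunction N ∧
      (∀ ω, IsClosed (N ω)) ∧ (∀ ω, (N ω).Nonempty) ∧
      ∀ ω, ∀ p ∈ N ω, p ∈ M ω ∧ dist p e = Metric.infDist e (M ω) := by
    intro M hM hc hne e
    refine ⟨fun ω => M ω ∩ Metric.closedBall e (Metric.infDist e (M ω)),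
      hM.inter_closedBall hc e (hM.measurable_infDist hne e),
      fun ω => (hc ω).inter Metric.isClosed_closedBall, fun ω => ?_, fun ω p hp => ⟨hp.1, ?_⟩⟩
    · obtain ⟨p, hp, hd⟩ := (hc ω).exists_infDist_eq_dist (hne ω) e
      exact ⟨p, hp, by rw [Metric.mem_closedBall, dist_comm, hd]⟩
    · refine le_antisymm hp.2 ?_
      rw [dist_comm]
      exact Metric.infDist_le_dist_of_mem hp.1
  induction L with
  | nil =>
    obtain ⟨N, h1, h2, h3, h4⟩ := step M hM hc hne e
    exact ⟨N, h1, h2, h3, h4, by simp⟩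
  | cons a L ih =>
    obtain ⟨N, h1, h2, h3, h4, h5⟩ := ih
    obtain ⟨N', h1', h2', h3', h4'⟩ := step N h1 h2 h3 a
    refine ⟨N', h1', h2', h3', fun ω p hp => h4 ω p (h4' ω p hp).1, fun b hb => ?_⟩
    rcases List.mem_cons.1 hb with rfl | hb
    · exact ⟨_, h1.measurable_infDist h3 b, fun ω p hp => (h4' ω p hp).2⟩
    · obtain ⟨r, hr, hd⟩ := h5 b hb
      exact ⟨r, hr, fun ω p hp => hd ω p (h4' ω p hp).1⟩

/-- A measurable closed-valued multifunction has a measurable selection of nearest points. -/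
theorem MeasurableMultifunction.exists_measurable_nearest {n : ℕ}
    {M : Ω → Set (EuclideanSpace ℝ (Fin n))} (hM : MeasurableMultifunction M)
    (hc : ∀ ω, IsClosed (M ω)) (hne : ∀ ω, (M ω).Nonempty) (e : EuclideanSpace ℝ (Fin n)) :
    ∃ p : Ω → EuclideanSpace ℝ (Fin n), Measurable p ∧
      ∀ ω, p ω ∈ M ω ∧ dist (p ω) e = Metric.infDist e (M ω) := by
  obtain ⟨N, -, -, h3, h4, h5⟩ := hM.exists_subset_nearest hc hne e
    (0 :: List.ofFn fun i : Fin n => EuclideanSpace.single i (1 : ℝ))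
  choose p hp using h3
  obtain ⟨r, hr, hr'⟩ := h5 0 List.mem_cons_self
  have hs : ∀ i : Fin n, ∃ s : Ω → ℝ, Measurable s ∧
      ∀ ω, ∀ p ∈ N ω, dist p (EuclideanSpace.single i (1 : ℝ)) = s ω :=
    fun i => h5 _ (List.mem_cons_of_mem _ (List.mem_ofFn.2 ⟨i, rfl⟩))
  choose s hs hs' using hs
  refine ⟨p, ?_, fun ω => h4 ω _ (hp ω)⟩
  -- Polarization: the distances to `0` and to the standard basis vectors determine every
  -- coordinate, so any choice from `N` is measurable.
  have hp' : p = fun ω => WithLp.toLp 2 fun i => (1 + r ω ^ 2 - s i ω ^ 2) / 2 := by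
    funext ω
    ext i
    have h1 := hr' ω _ (hp ω)
    have h2 := hs' i ω _ (hp ω)
    rw [dist_zero_right] at h1
    rw [dist_eq_norm] at h2
    change p ω i = (1 + r ω ^ 2 - s i ω ^ 2) / 2
    rw [← h1, ← h2, norm_sub_sq_real, EuclideanSpace.inner_single_right]
    simp
    ring
  rw [hp']
  exact (WithLp.measurable_toLp 2 _).comp (measurable_pi_lambda _ fun i => by
    have := hs i
    fun_prop)

theorem MeasurableMultifunction.contingentCone {E : Type*} [NormedAddCommGroup E]
    [InnerProductSpace ℝ E] [ProperSpace E] {M : Ω → Set E} (hM : MeasurableMultifunction M)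
    (x : E) : MeasurableMultifunction fun ω => contingentCone x (M ω) := by
  refine measurableMultifunction_of_isCompact fun C hC => ?_
  have : {ω | (VarAn.contingentCone x (M ω) ∩ C).Nonempty} =
      -- The union over `t` is uncountable but open, so measurability of `M` applies to it directly.
      ⋂ m : ℕ, {ω | (M ω ∩ ⋃ t ∈ Set.Ioo (0 : ℝ) (1 / ((m : ℝ) + 1)), (fun y => t⁻¹ • (y - x)) ⁻¹'
        Metric.thickening (1 / ((m : ℝ) + 1)) C).Nonempty} := by
    ext ω
    simp only [Set.mem_ofPred_eq, Set.mem_iInter]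
    constructor
    · rintro ⟨v, hv, hvC⟩ m
      obtain ⟨t, ht, htm, w, hw, hS⟩ := mem_contingentCone_iff.1 hv (1 / ((m : ℝ) + 1))
        (by positivity)
      refine ⟨_, hS, Set.mem_biUnion (show t ∈ Set.Ioo _ _ from ⟨ht, htm⟩) ?_⟩
      rw [Set.mem_preimage, add_sub_cancel_left, smul_smul, inv_mul_cancel₀ ht.ne', one_smul]
      exact Metric.mem_thickening_iff.2 ⟨v, hvC, hw⟩
    · intro h
      choose y hy hyU using h
      simp only [Set.mem_iUnion, Set.mem_preimage] at hyU
      choose t ht hthick using hyU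
      obtain ⟨c, hcC, φ, hφ, hlim⟩ := exists_tendsto_subseq_of_dist_lt hC hthick
      refine ⟨c, ⟨fun k => t (φ k), _, fun k => (ht _).1, ?_, hlim, fun k => ?_⟩, hcC⟩
      · exact squeeze_zero (fun k => (ht _).1.le) (fun k => (ht _).2.le)
          (tendsto_one_div_add_atTop_nhds_zero_nat.comp hφ.tendsto_atTop)
      · have : x + t (φ k) • (t (φ k))⁻¹ • (y (φ k) - x) = y (φ k) := by
          rw [smul_smul, mul_inv_cancel₀ (ht _).1.ne', one_smul, add_sub_cancel]
        simpa [this] using hy (φ k)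
  rw [this]
  exact .iInter fun m => hM _ (isOpen_biUnion fun t _ =>
    Metric.isOpen_thickening.preimage (by fun_prop))

theorem MeasurableMultifunction.measurableSet_mem {E : Type*} [MetricSpace E]
    {M : Ω → Set E} (hM : MeasurableMultifunction M) (hc : ∀ ω, IsClosed (M ω)) (x : E) :
    MeasurableSet {ω | x ∈ M ω} := by
  have : {ω | x ∈ M ω} = ⋂ m : ℕ, {ω | (M ω ∩ Metric.ball x (1 / ((m : ℝ) + 1))).Nonempty} := by
    ext ω
    simp only [Set.mem_ofPred_eq, Set.mem_iInter]
    refine ⟨fun h m => ⟨x, h, Metric.mem_ball_self (by positivity)⟩, fun h => ?_⟩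
    rw [← (hc ω).closure_eq, Metric.mem_closure_iff]
    intro ε hε
    obtain ⟨m, hm⟩ := exists_nat_one_div_lt hε
    obtain ⟨y, hy, hyx⟩ := h m
    exact ⟨y, hy, by rw [dist_comm]; exact (Metric.mem_ball.1 hyx).trans hm⟩
  rw [this]
  exact .iInter fun m => hM _ Metric.isOpen_ball

theorem isClosed_essInter {E : Type*} [MetricSpace E] {μ : Measure Ω} {M : Ω → Set E}
    (hc : ∀ ω, IsClosed (M ω)) : IsClosed (essInter μ M) := by
  refine IsSeqClosed.isClosed fun u x hu hx => ?_
  have : ∀ᵐ ω ∂μ, ∀ k, u k ∈ M ω := ae_all_iff.2 hu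
  filter_upwards [this] with ω hω
  exact (hc ω).mem_of_tendsto hx (Eventually.of_forall hω)

end Measurability

/-! ### Regular normals to an essential intersection. -/

section EssentialIntersection

variable {Ω : Type*} [MeasurableSpace Ω] {n : ℕ}

theorem exists_integral_nearest_of_forall_mem {μ : Measure Ω} [SigmaFinite μ]
    {M : Ω → Set (EuclideanSpace ℝ (Fin n))} (hM : MeasurableMultifunction M)
    (hc : ∀ ω, IsClosed (M ω)) {x v : EuclideanSpace ℝ (Fin n)} (hx : ∀ ω, x ∈ M ω)
    (hv : v ∈ regularNormalCone x (essInter μ M)) {ε : ℝ} (hε : 0 < ε) :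
    ∃ (y : EuclideanSpace ℝ (Fin n)) (p : Ω → EuclideanSpace ℝ (Fin n)) (g : Ω → ℝ),
      (∀ ω, 0 ≤ g ω) ∧ (∀ ω, p ω ∈ M ω ∧ ∀ q ∈ M ω, ‖y - p ω‖ ≤ ‖y - q‖) ∧
      Integrable (fun ω => g ω • (y - p ω)) μ ∧ ‖v - ∫ ω, g ω • (y - p ω) ∂μ‖ ≤ ε := by
  have hne : ∀ ω, (M ω).Nonempty := fun ω => ⟨x, hx ω⟩
  obtain ⟨ρ', hρpos, hρm, hρi⟩ := exists_pos_lintegral_lt_of_sigmaFinite μ one_ne_zero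
  let ρ : Ω → ℝ := fun ω => ρ' ω
  have hρ0 : ∀ ω, 0 < ρ ω := fun ω => hρpos ω
  have hρmeas : Measurable ρ := hρm.coe_nnreal_real
  have hρint : Integrable ρ μ := by
    refine ⟨hρmeas.aestronglyMeasurable, ?_⟩
    rw [hasFiniteIntegral_iff_ofReal (Eventually.of_forall fun ω => (hρ0 ω).le)]
    simpa [ρ] using hρi.trans ENNReal.one_lt_top
  let D : EuclideanSpace ℝ (Fin n) → Ω → ℝ := fun y ω => Metric.infDist y (M ω)
  have hDm : ∀ y, Measurable (D y) := fun y => hM.measurable_infDist hne y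
  have hD0 : ∀ y ω, 0 ≤ D y ω := fun y ω => Metric.infDist_nonneg
  have hDle : ∀ y ω, D y ω ≤ dist y x := fun y ω => Metric.infDist_le_dist_of_mem (hx ω)
  have hDmeas : ∀ y, Measurable fun ω => ρ ω * D y ω ^ 2 := fun y =>
    hρmeas.mul ((hDm y).pow_const 2)
  have hDbound : ∀ y R, dist y x ≤ R → ∀ ω, ‖ρ ω * D y ω ^ 2‖ ≤ ρ ω * R ^ 2 := by
    intro y R hR ω
    have h0 := hρ0 ω
    have h1 := hD0 y ω
    have h2 := (hDle y ω).trans hR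
    rw [Real.norm_of_nonneg (by positivity)]
    gcongr
  have hDint : ∀ y, Integrable (fun ω => ρ ω * D y ω ^ 2) μ := fun y =>
    (hρint.mul_const _).mono' (hDmeas y).aestronglyMeasurable
      (Eventually.of_forall (hDbound y _ le_rfl))
  obtain ⟨δ, hδ, hball⟩ := Metric.mem_nhdsWithin_iff.1 (hv.2 (ε / 2) (half_pos hε))
  have hδ2 : 0 < δ / 2 := half_pos hδ
  -- On the essential intersection `⟪v, y - x⟫ ≤ (ε / 2) * ‖y - x‖`, so the slope `ε` in `f` makes
  -- `x` the only point of the ball with `φ = 0` and `f ≤ 0`.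
  obtain ⟨k, hk, y, -, hyU, hmin⟩ := exists_isMinOn_add_mul
    (B := Metric.closedBall x (δ / 2)) (U := Metric.ball x (δ / 2))
    (f := fun y => -⟪v, y - x⟫ + ε * ‖y - x‖) (φ := fun y => ∫ ω, ρ ω * D y ω ^ 2 ∂μ)
    (x₀ := x) (isCompact_closedBall _ _) (by fun_prop)
    (continuousOn_of_dominated (bound := fun ω => ρ ω * (δ / 2) ^ 2)
      (fun y _ => (hDmeas y).aestronglyMeasurable)
      (fun y hy => Eventually.of_forall (hDbound y _ hy)) (hρint.mul_const _)
      (Eventually.of_forall fun ω => (continuous_const.mul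
        ((Metric.continuous_infDist_pt (M ω)).pow 2)).continuousOn))
    (fun y _ => integral_nonneg fun ω => mul_nonneg (hρ0 ω).le (sq_nonneg _))
    (Metric.mem_closedBall_self hδ2.le) (by simp)
    (by simp [D, Metric.infDist_zero_of_mem (hx _)])
    (by
      intro y hy hφ hf
      rw [integral_eq_zero_iff_of_nonneg (fun ω => mul_nonneg (hρ0 ω).le (sq_nonneg _))
        (hDint y)] at hφ
      have hyM : y ∈ essInter μ M := by
        filter_upwards [hφ] with ω hω
        have h1 : D y ω = 0 := by
          have := (mul_eq_zero.1 (show ρ ω * D y ω ^ 2 = 0 from hω)).resolve_left (hρ0 ω).ne'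
          exact pow_eq_zero_iff two_ne_zero |>.1 this
        exact ((hc ω).mem_iff_infDist_zero (hne ω)).2 h1
      have h2 : ⟪v, y - x⟫ ≤ ε / 2 * ‖y - x‖ :=
        hball ⟨Metric.mem_ball.2 ((Metric.mem_closedBall.1 hy).trans_lt (half_lt_self hδ)), hyM⟩
      have h3 : ‖y - x‖ ≤ 0 := by
        by_contra hpos
        push Not at hpos
        have := mul_pos hε hpos
        linarith
      exact sub_eq_zero.1 (norm_le_zero_iff.1 h3))
    (Metric.ball_mem_nhds x hδ2)
  obtain ⟨p, hpm, hp⟩ := hM.exists_measurable_nearest hc hne y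
  have hpD : ∀ ω, ‖y - p ω‖ = D y ω := fun ω => by
    rw [← dist_eq_norm, dist_comm]
    exact (hp ω).2
  have hIint : Integrable (fun ω => ρ ω • (y - p ω)) μ := by
    refine (hρint.mul_const (dist y x)).mono'
      (hρmeas.smul (measurable_const.sub hpm)).aestronglyMeasurable
      (Eventually.of_forall fun ω => ?_)
    rw [norm_smul, Real.norm_of_nonneg (hρ0 ω).le, hpD]
    exact mul_le_mul_of_nonneg_left (hDle y ω) (hρ0 ω).le
  set I := ∫ ω, ρ ω • (y - p ω) ∂μ with hI
  set R := ∫ ω, ρ ω ∂μ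
  -- The squared distance is majorized by `‖z - p ω‖^2`, with equality at `z = y`. This quadratic
  -- upper model supplies a gradient `2 * I` without differentiating under the integral.
  have hupper : ∀ z, ∫ ω, ρ ω * D z ω ^ 2 ∂μ ≤
      ∫ ω, ρ ω * D y ω ^ 2 ∂μ + 2 * ⟪I, z - y⟫ + R * ‖z - y‖ ^ 2 := by
    intro z
    have e1 : Integrable (fun ω => ⟪z - y, ρ ω • (y - p ω)⟫) μ := hIint.const_inner _
    have e2 : Integrable (fun ω => ρ ω * D y ω ^ 2 + 2 * ⟪z - y, ρ ω • (y - p ω)⟫) μ :=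
      (hDint y).add (e1.const_mul 2)
    calc ∫ ω, ρ ω * D z ω ^ 2 ∂μ
        ≤ ∫ ω, (ρ ω * D y ω ^ 2 + 2 * ⟪z - y, ρ ω • (y - p ω)⟫ + ρ ω * ‖z - y‖ ^ 2) ∂μ := by
          refine integral_mono (hDint z)
            (e2.add (hρint.mul_const _)) fun ω => ?_
          have h1 : D z ω ≤ ‖(z - y) + (y - p ω)‖ := by
            rw [sub_add_sub_cancel, ← dist_eq_norm]
            exact Metric.infDist_le_dist_of_mem (hp ω).1
          have h2 : D z ω ^ 2 ≤ ‖(z - y) + (y - p ω)‖ ^ 2 := by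
            have := hD0 z ω
            gcongr
          rw [norm_add_sq_real, hpD] at h2
          have h3 := mul_le_mul_of_nonneg_left h2 (hρ0 ω).le
          simp only [real_inner_smul_right]
          linarith
      _ = _ := by
          rw [integral_add e2 (hρint.mul_const _),
            integral_add (hDint y) (e1.const_mul 2), integral_const_mul, integral_mul_const,
            integral_inner hIint, real_inner_comm]
  have hgi : ∀ ω, (2 * k * ρ ω) • (y - p ω) = (2 * k) • (ρ ω • (y - p ω)) := fun ω =>
    mul_smul _ _ _
  refine ⟨y, p, fun ω => 2 * k * ρ ω, fun ω => ?_, fun ω => ⟨(hp ω).1, fun q hq => ?_⟩, ?_, ?_⟩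
  · have := (hρ0 ω).le
    positivity
  · rw [hpD, ← dist_eq_norm]
    exact Metric.infDist_le_dist_of_mem hq
  · simp only [hgi]
    exact hIint.smul (2 * k)
  · simp only [hgi]
    rw [integral_smul, ← hI]
    have hev : ∀ᶠ z in 𝓝 y, ⟪v - (2 * k) • I, z - y⟫ ≤ ε * ‖z - y‖ + (k * R) * ‖z - y‖ ^ 2 := by
      filter_upwards [Metric.isOpen_ball.mem_nhds hyU] with z hz
      have h1 := hmin z (Metric.ball_subset_closedBall hz)
      have h2 := mul_le_mul_of_nonneg_left (hupper z) hk
      have h3 : ‖z - x‖ ≤ ‖z - y‖ + ‖y - x‖ := norm_sub_le_norm_sub_add_norm_sub _ _ _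
      have h4 := mul_le_mul_of_nonneg_left h3 hε.le
      have h5 : ⟪v, z - y⟫ = ⟪v, z - x⟫ - ⟪v, y - x⟫ := by
        rw [← inner_sub_right, sub_sub_sub_cancel_right]
      rw [inner_sub_left, real_inner_smul_left, h5]
      linarith
    rcases norm_le_of_eventually_inner_le hev with h | h
    · exact h
    · rw [h, norm_zero]
      exact hε.le

/-- A regular normal to an essential intersection is approximated by integrals of proximal
normals to the values of the multifunction. -/
theorem exists_integral_nearest {μ : Measure Ω} [SigmaFinite μ]
    {M : Ω → Set (EuclideanSpace ℝ (Fin n))} (hM : MeasurableMultifunction M)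
    (hc : ∀ ω, IsClosed (M ω)) {x v : EuclideanSpace ℝ (Fin n)}
    (hv : v ∈ regularNormalCone x (essInter μ M)) {ε : ℝ} (hε : 0 < ε) :
    ∃ (y : EuclideanSpace ℝ (Fin n)) (p : Ω → EuclideanSpace ℝ (Fin n)) (g : Ω → ℝ),
      (∀ ω, 0 ≤ g ω) ∧ (∀ᵐ ω ∂μ, p ω ∈ M ω ∧ ∀ q ∈ M ω, ‖y - p ω‖ ≤ ‖y - q‖) ∧
      Integrable (fun ω => g ω • (y - p ω)) μ ∧ ‖v - ∫ ω, g ω • (y - p ω) ∂μ‖ ≤ ε := by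
  classical
  -- Only a null set of values is altered, and afterwards `x` lies in every value.
  let N : Ω → Set (EuclideanSpace ℝ (Fin n)) := fun ω => if x ∈ M ω then M ω else Set.univ
  have hx : ∀ᵐ ω ∂μ, x ∈ M ω := hv.1
  have hNM : ∀ᵐ ω ∂μ, N ω = M ω := hx.mono fun ω hω => if_pos hω
  have hN : MeasurableMultifunction N := by
    intro U hU
    have : {ω | (N ω ∩ U).Nonempty} = ({ω | x ∈ M ω} ∩ {ω | (M ω ∩ U).Nonempty}) ∪
        ({ω | x ∈ M ω}ᶜ ∩ {_ω | U.Nonempty}) := by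
      ext ω
      by_cases h : x ∈ M ω <;> simp [N, h]
    rw [this]
    have hm := hM.measurableSet_mem hc x
    exact (hm.inter (hM U hU)).union (hm.compl.inter (.const _))
  have hNc : ∀ ω, IsClosed (N ω) := fun ω => by
    by_cases h : x ∈ M ω
    · simpa [N, h] using hc ω
    · simp [N, h]
  have hNx : ∀ ω, x ∈ N ω := fun ω => by
    by_cases h : x ∈ M ω <;> simp [N, h]
  have hess : essInter μ N = essInter μ M := by
    ext y
    exact eventually_congr (hNM.mono fun ω hω => by rw [hω])
  obtain ⟨y, p, g, hg, hp, hi, hle⟩ :=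
    exists_integral_nearest_of_forall_mem hN hNc hNx (hess ▸ hv) hε
  exact ⟨y, p, g, hg, hNM.mono fun ω hω => hω ▸ hp ω, hi, hle⟩

/-- If proximal normals to the values of `T` belong to the cones `K ω`, then the regular normals
to the essential intersection of `T` belong to the closed Aumann integral of `K`. -/
theorem mem_closure_aumannIntegral {μ : Measure Ω} [SigmaFinite μ]
    {T K : Ω → Set (EuclideanSpace ℝ (Fin n))} (hT : MeasurableMultifunction T)
    (hc : ∀ ω, IsClosed (T ω))
    (hK : ∀ᵐ ω ∂μ, ∀ c : ℝ, 0 ≤ c → ∀ u ∈ K ω, c • u ∈ K ω)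
    (hTK : ∀ᵐ ω ∂μ, ∀ y, ∀ p ∈ T ω, (∀ q ∈ T ω, ‖y - p‖ ≤ ‖y - q‖) → y - p ∈ K ω)
    {x v : EuclideanSpace ℝ (Fin n)} (hv : v ∈ regularNormalCone x (essInter μ T)) :
    v ∈ closure (aumannIntegral μ K) := by
  refine Metric.mem_closure_iff.2 fun ε hε => ?_
  obtain ⟨y, p, g, hg, hp, hi, hle⟩ := exists_integral_nearest hT hc hv (half_pos hε)
  refine ⟨_, ⟨_, hi, ?_, rfl⟩, ?_⟩
  · filter_upwards [hp, hK, hTK] with ω h1 h2 h3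
    exact h2 _ (hg ω) _ (h3 y _ h1.1 h1.2)
  · rw [dist_eq_norm]
    linarith

end EssentialIntersection

/-! ### Fuzzy optimality conditions and the limiting sum rule. -/

section SumRule

theorem isClosed_epigraph_inter {X : Type*} [MetricSpace X] {B : Set X} {h : X → EReal}
    (hB : IsClosed B)
    (hlsc : ∀ x ∈ B, LowerSemicontinuousAt h x) :
    IsClosed {p : X × ℝ × X | p.1 ∈ B ∧ h p.1 ≤ (p.2.1 : EReal)} := by
  refine IsSeqClosed.isClosed fun u p hu hp => ?_
  have h1 : Tendsto (fun k => (u k).1) atTop (𝓝 p.1) := (continuous_fst.tendsto p).comp hp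
  have h2 : Tendsto (fun k => (((u k).2.1 : ℝ) : EReal)) atTop (𝓝 (p.2.1 : EReal)) :=
    ((continuous_coe_real_ereal.comp (continuous_fst.comp continuous_snd)).tendsto p).comp hp
  have hpB : p.1 ∈ B := hB.mem_of_tendsto h1 (Eventually.of_forall fun k => (hu k).1)
  refine ⟨hpB, ?_⟩
  by_contra! hlt
  obtain ⟨c, hc1, hc2⟩ := exists_between hlt
  obtain ⟨k, hk1, hk2⟩ := ((h1.eventually (hlsc _ hpB c hc2)).and
    (h2.eventually (gt_mem_nhds hc1))).exists
  exact absurd ((hu k).2) (not_le.2 (hk2.trans hk1))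

variable {E : Type*} [NormedAddCommGroup E] [InnerProductSpace ℝ E]

/-- Fuzzy optimality conditions: near a local minimizer `x` of `h` over `C`, a normal `w` to `C`
is opposite to a regular subgradient of `h` up to the small vector `2 (a - x)`. -/
theorem exists_regularNormal_near_minimizer [ProperSpace E] {C : Set E} (hC : IsClosed C)
    {h : E → EReal} (hbot : ∀ x, h x ≠ ⊥) {x : E}
    (hlsc : ∀ᶠ y in 𝓝 x, LowerSemicontinuousAt h y) (hdom : h x ≠ ⊤) (hx : x ∈ C)
    (hmin : IsLocalMinOn h C x) {ε : ℝ} (hε : 0 < ε) :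
    ∃ (a y w : E) (α : ℝ), dist a x < ε ∧ dist y x < ε ∧ dist α (h x).toReal < ε ∧
      w ∈ regularNormalCone y C ∧
      WithLp.toLp 2 (-((2 : ℝ) • (a - x)) - w, (-1 : ℝ)) ∈
        regularNormalCone (WithLp.toLp 2 (a, α)) (epi h) := by
  set a₀ := (h x).toReal with ha₀
  have hcoe : (a₀ : EReal) = h x := EReal.coe_toReal hdom (hbot x)
  obtain ⟨δ, hδ, hδ'⟩ := Metric.nhds_basis_closedBall.eventually_iff.1
    (hlsc.and (eventually_nhdsWithin_iff.1 hmin))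
  obtain ⟨b, -, hb⟩ := LowerSemicontinuousOn.exists_isMinOn ⟨x, Metric.mem_closedBall_self hδ.le⟩
    (isCompact_closedBall x δ)
    (fun y hy => (hδ' hy).1.lowerSemicontinuousWithinAt _)
  have hbtop : h b ≠ ⊤ := fun h0 => hdom (top_le_iff.1 (h0 ▸ hb (Metric.mem_closedBall_self hδ.le)))
  set m := (h b).toReal
  have hm : ∀ y ∈ Metric.closedBall x δ, (m : EReal) ≤ h y := fun y hy => by
    rw [EReal.coe_toReal hbtop (hbot b)]
    exact hb hy
  -- Decoupled triples: a point of the epigraph of `h` and a separate point of `C`. The lower bound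
  -- `m` of `h` on the ball and the cap `a₀ + 1` make the height range compact.
  let B : Set (E × ℝ × E) :=
    (Metric.closedBall x δ ×ˢ (Set.Icc m (a₀ + 1) ×ˢ (Metric.closedBall x δ ∩ C))) ∩
      {p | p.1 ∈ Metric.closedBall x δ ∧ h p.1 ≤ (p.2.1 : EReal)}
  have hBmem : ∀ (u : E) (s : ℝ) (z : E), u ∈ Metric.closedBall x δ → z ∈ Metric.closedBall x δ → z ∈ C →
      h u ≤ (s : EReal) → s ≤ a₀ + 1 → (u, s, z) ∈ B := fun u s z hu hz hzC hs hs1 =>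
    ⟨⟨hu, ⟨EReal.coe_le_coe_iff.1 ((hm u hu).trans hs), hs1⟩, hz, hzC⟩, hu, hs⟩
  have hBc : IsCompact B :=
    ((isCompact_closedBall x δ).prod (isCompact_Icc.prod
      ((isCompact_closedBall x δ).inter_right hC))).inter_right
      (isClosed_epigraph_inter Metric.isClosed_closedBall fun y hy => (hδ' hy).1)
  set r := min ε (min δ 1) with hr
  have hr0 : 0 < r := by positivity
  -- The term `‖p.1 - x‖ ^ 2` makes `x` the strict minimizer when the two points coincide, and `φ`
  -- penalizes their separation. Varying only the point of `C` gives the normal `(2 * k) • (a - y)`;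
  -- varying only the epigraph point gives its opposite up to `2 • (a - x)`.
  obtain ⟨k, hk, ⟨a, α, y⟩, hmemB, hU, hle⟩ := exists_isMinOn_add_mul (B := B)
    (U := Metric.ball (x, a₀, x) r) (x₀ := (x, a₀, x))
    (f := fun p => p.2.1 - a₀ + ‖p.1 - x‖ ^ 2) (φ := fun p => ‖p.1 - p.2.2‖ ^ 2)
    hBc (by fun_prop) (by fun_prop) (fun _ _ => sq_nonneg _)
    (hBmem _ _ _ (Metric.mem_closedBall_self hδ.le) (Metric.mem_closedBall_self hδ.le) hx
      hcoe.ge (by linarith))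
    (by simp) (by simp)
    (by
      rintro ⟨u, s, z⟩ ⟨⟨hu, -, -, hzC⟩, -, hus⟩ hφ hf
      have huz : u = z := by
        have := pow_eq_zero_iff two_ne_zero |>.1 hφ
        exact sub_eq_zero.1 (norm_eq_zero.1 this)
      subst huz
      have h1 : a₀ ≤ s := by
        rw [← EReal.coe_le_coe_iff, hcoe]
        exact ((hδ' hu).2 hzC).trans hus
      simp only at hf
      have h2 : ‖u - x‖ ^ 2 = 0 := le_antisymm (by linarith) (sq_nonneg _)
      have h3 : s = a₀ := by linarith
      have h4 : u = x := sub_eq_zero.1 (norm_eq_zero.1 (pow_eq_zero_iff two_ne_zero |>.1 h2))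
      rw [h3, h4])
    (Metric.ball_mem_nhds _ hr0)
  obtain ⟨⟨-, -, -, hyC⟩, -, haα⟩ := hmemB
  simp only [Metric.mem_ball, Prod.dist_eq, max_lt_iff] at hU
  obtain ⟨hax, hαa, hyx⟩ := hU
  have hrε : r ≤ ε := min_le_left _ _
  have hrδ : r ≤ δ := (min_le_right _ _).trans (min_le_left _ _)
  have hr1 : r ≤ 1 := (min_le_right _ _).trans (min_le_right _ _)
  simp only at hyC haα
  have hα1 : α < a₀ + 1 := by
    rw [Real.dist_eq] at hαa
    linarith [le_abs_self (α - a₀)]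
  have haB : a ∈ Metric.ball x δ := hax.trans_le hrδ
  have hyB : y ∈ Metric.ball x δ := hyx.trans_le hrδ
  refine ⟨a, y, (2 * k) • (a - y), α, hax.trans_le hrε, hyx.trans_le hrε, hαa.trans_le hrε, ?_, ?_⟩
  · refine mem_regularNormalCone_of_quadratic (c := k) hyC ?_
    filter_upwards [self_mem_nhdsWithin,
      mem_nhdsWithin_of_mem_nhds (Metric.isOpen_ball.mem_nhds hyB)] with z hzC hz
    have h1 := hle _ (hBmem a α z (Metric.ball_subset_closedBall haB)
      (Metric.ball_subset_closedBall hz) hzC haα hα1.le)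
    simp only at h1
    have h2 : a - z = (a - y) - (z - y) := by abel
    rw [h2, norm_sub_sq_real (a - y)] at h1
    rw [real_inner_smul_left]
    linarith
  · refine mem_regularNormalCone_of_quadratic (c := 1 + k) haα ?_
    have hc1 : Continuous fun q : WithLp 2 (E × ℝ) => q.fst :=
      continuous_fst.comp (WithLp.prod_continuous_ofLp 2 E ℝ)
    have hc2 : Continuous fun q : WithLp 2 (E × ℝ) => q.snd :=
      continuous_snd.comp (WithLp.prod_continuous_ofLp 2 E ℝ)
    filter_upwards [self_mem_nhdsWithin,
      mem_nhdsWithin_of_mem_nhds ((hc1.tendsto (WithLp.toLp 2 (a, α))).eventually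
        (Metric.isOpen_ball.mem_nhds haB)),
      mem_nhdsWithin_of_mem_nhds ((hc2.tendsto (WithLp.toLp 2 (a, α))).eventually
        (gt_mem_nhds hα1))] with q hq hq1 hq2
    have h1 := hle _ (hBmem q.fst q.snd y (Metric.ball_subset_closedBall hq1)
      (Metric.ball_subset_closedBall hyB) hyC hq hq2.le)
    simp only at h1
    have h2 : q.fst - x = (a - x) + (q.fst - a) := by abel
    have h3 : q.fst - y = (a - y) + (q.fst - a) := by abel
    rw [h2, h3, norm_add_sq_real (a - x), norm_add_sq_real (a - y)] at h1
    have h4 : ‖q - WithLp.toLp 2 (a, α)‖ ^ 2 = ‖q.fst - a‖ ^ 2 + ‖q.snd - α‖ ^ 2 :=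
      WithLp.prod_norm_sq_eq_of_L2 _
    have h5 : ⟪WithLp.toLp 2 (-((2 : ℝ) • (a - x)) - (2 * k) • (a - y), (-1 : ℝ)),
        q - WithLp.toLp 2 (a, α)⟫ =
        ⟪-((2 : ℝ) • (a - x)) - (2 * k) • (a - y), q.fst - a⟫ + (q.snd - α) * (-1) := rfl
    rw [h4, h5, inner_sub_left, inner_neg_left, real_inner_smul_left, real_inner_smul_left]
    have h6 := mul_nonneg (add_nonneg zero_le_one hk) (sq_nonneg ‖q.snd - α‖)
    linarith

/-- Either the basic subdifferential or the singular subdifferential at a local minimizer over `C`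
contains the opposite of a limiting normal to `C`, which is nonzero in the second case. -/
theorem exists_limitingNormal_of_isLocalMinOn [ProperSpace E] {C : Set E} (hC : IsClosed C)
    {h : E → EReal} (hbot : ∀ x, h x ≠ ⊥) {x : E}
    (hlsc : ∀ᶠ y in 𝓝 x, LowerSemicontinuousAt h y) (hdom : h x ≠ ⊤) (hx : x ∈ C)
    (hmin : IsLocalMinOn h C x) :
    (∃ w ∈ limitingNormalCone x C, -w ∈ basicSubdifferential h x) ∨
      ∃ w ∈ limitingNormalCone x C, w ≠ 0 ∧ -w ∈ singularSubdifferential h x := by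
  choose a y w α ha hy hα hw hn using fun j : ℕ =>
    exists_regularNormal_near_minimizer hC hbot hlsc hdom hx hmin
      (ε := 1 / ((j : ℝ) + 1)) (by positivity)
  have hbase : WithLp.toLp 2 (x, (h x).toReal) ∈ epi h :=
    (EReal.coe_toReal hdom (hbot x)).ge
  have hlima := tendsto_of_dist_lt_one_div ha
  have hlimy := tendsto_of_dist_lt_one_div hy
  have hlimα := tendsto_of_dist_lt_one_div hα
  have key : ∀ (φ : ℕ → ℕ) (t : ℕ → ℝ) (s : ℝ) (u : E), StrictMono φ → (∀ j, 0 ≤ t j) →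
      Tendsto t atTop (𝓝 s) → Tendsto (fun j => t j • w (φ j)) atTop (𝓝 u) →
      u ∈ limitingNormalCone x C ∧
        WithLp.toLp 2 (-u, -s) ∈ limitingNormalCone (WithLp.toLp 2 (x, (h x).toReal)) (epi h) := by
    -- Scaling by `t` sends the last component `-1` to `-s`: `t = 1` gives a basic subgradient if
    -- `w` has a bounded subsequence, and `t = ‖w‖⁻¹` a singular one if `‖w‖ → ∞`.
    intro φ t s u hφ ht hts hu
    have hcont := WithLp.prod_continuous_toLp 2 E ℝ
    have hφt := hφ.tendsto_atTop
    refine ⟨⟨hx, fun j => y (φ j), _, fun j => (hw (φ j)).1, hlimy.comp hφt,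
      fun j => regularNormalCone_smul (hw (φ j)) (ht j), hu⟩, hbase,
      fun j => WithLp.toLp 2 (a (φ j), α (φ j)), _, fun j => (hn (φ j)).1,
      (hcont.tendsto (x, (h x).toReal)).comp
        ((hlima.comp hφt).prodMk_nhds (hlimα.comp hφt)),
      fun j => regularNormalCone_smul (hn (φ j)) (ht j), ?_⟩
    have h0 : Tendsto (fun j => (2 : ℝ) • (a (φ j) - x)) atTop (𝓝 0) := by
      simpa using ((hlima.comp hφt).sub_const x).const_smul (2 : ℝ)
    have h1 : Tendsto (fun j => t j • (-((2 : ℝ) • (a (φ j) - x)) - w (φ j))) atTop (𝓝 (-u)) := by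
      have := (hts.smul h0).neg.sub hu
      simpa [smul_sub] using this
    have h2 : Tendsto (fun j => t j • (-1 : ℝ)) atTop (𝓝 (-s)) := by
      simpa using hts.neg
    exact (hcont.tendsto (-u, -s)).comp (h1.prodMk_nhds h2)
  by_cases hbdd : ∃ R : ℝ, ∃ᶠ j in atTop, ‖w j‖ ≤ R
  · left
    obtain ⟨R, hR⟩ := hbdd
    obtain ⟨u, -, φ, hφ, hu⟩ := tendsto_subseq_of_frequently_bounded
      (Metric.isBounded_closedBall (x := (0 : E)) (r := R)) (hR.mono fun j hj => by simpa using hj)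
    obtain ⟨h1, h2⟩ := key φ (fun _ => 1) 1 u hφ (fun _ => zero_le_one) tendsto_const_nhds
      (by simp only [one_smul]; exact hu)
    exact ⟨u, h1, h2⟩
  · right
    push Not at hbdd
    have htop : Tendsto (fun j => ‖w j‖) atTop atTop :=
      tendsto_atTop.2 fun R => (hbdd R).mono fun j hj => hj.le
    have hunit : ∀ᶠ j in atTop, ‖w j‖⁻¹ • w j ∈ Metric.sphere (0 : E) 1 := by
      filter_upwards [hbdd 0] with j hj
      rw [mem_sphere_zero_iff_norm, norm_smul, norm_inv, norm_norm, inv_mul_cancel₀ hj.ne']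
    obtain ⟨u, hu, φ, hφ, hlim⟩ := tendsto_subseq_of_frequently_bounded
      Metric.isBounded_sphere hunit.frequently
    rw [Metric.isClosed_sphere.closure_eq] at hu
    obtain ⟨h1, h2⟩ := key φ (fun j => ‖w (φ j)‖⁻¹) 0 u hφ (fun _ => by positivity)
      (htop.inv_tendsto_atTop.comp hφ.tendsto_atTop) hlim
    refine ⟨u, h1, ?_, ?_⟩
    · rintro rfl
      simp at hu
    · rwa [neg_zero] at h2

/-- The sum rule for a local minimizer over a closed set whose limiting normals lie in `K`. -/
theorem zero_mem_basicSubdifferential_add [ProperSpace E] {C K : Set E} (hC : IsClosed C)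
    {h : E → EReal} (hbot : ∀ x, h x ≠ ⊥) {x : E}
    (hlsc : ∀ᶠ y in 𝓝 x, LowerSemicontinuousAt h y) (hdom : h x ≠ ⊤) (hx : x ∈ C)
    (hmin : IsLocalMinOn h C x) (hK : limitingNormalCone x C ⊆ K)
    (hQ : (-singularSubdifferential h x) ∩ K = {0}) :
    0 ∈ basicSubdifferential h x + K := by
  rcases exists_limitingNormal_of_isLocalMinOn hC hbot hlsc hdom hx hmin with
    ⟨w, hw, hb⟩ | ⟨w, hw, hw0, hs⟩
  · exact ⟨-w, hb, w, hK hw, neg_add_cancel w⟩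
  · have : w ∈ (-singularSubdifferential h x) ∩ K := ⟨hs, hK hw⟩
    rw [hQ] at this
    exact absurd this hw0

end SumRule

/-! ### Limiting normals to the essential intersection in the two cases. -/

section NormalCones

variable {Ω : Type*} [MeasurableSpace Ω] {n : ℕ}

/-- Under the measurable CHIP and normal regularity, the normals to the essential intersection
belong to the closed Aumann integral of the normal cones. -/
theorem limitingNormalCone_essInter_subset_of_CHIP {μ : Measure Ω} [SigmaFinite μ]
    {M : Ω → Set (EuclideanSpace ℝ (Fin n))} (hM : MeasurableMultifunction M)
    (hc : ∀ ω, IsClosed (M ω)) {x : EuclideanSpace ℝ (Fin n)} (hx : x ∈ essInter μ M)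
    (hreg : NormallyRegularAt (essInter μ M) x) (hchip : MeasurableCHIP μ M x) :
    limitingNormalCone x (essInter μ M) ⊆
      closure (aumannIntegral μ fun ω => limitingNormalCone x (M ω)) := by
  intro v hv
  rw [← hreg] at hv
  have hx' : ∀ᵐ ω ∂μ, x ∈ M ω := hx
  have hv' : v ∈ regularNormalCone 0 (essInter μ fun ω => contingentCone x (M ω)) := by
    rw [← hchip]
    refine ⟨zero_mem_contingentCone hx, fun ε hε => ?_⟩
    filter_upwards [self_mem_nhdsWithin] with u hu
    rw [sub_zero]
    exact (inner_nonpos_of_mem_contingentCone hv hu).trans (by positivity)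
  exact mem_closure_aumannIntegral (hM.contingentCone x)
    (fun ω => isClosed_contingentCone x (M ω))
    (Eventually.of_forall fun ω c hc u hu => limitingNormalCone_smul hu hc)
    (hx'.mono fun ω hω y p hp hmin => sub_mem_limitingNormalCone_of_nearest (hc ω) hω hp hmin) hv'

/-- For cone-valued multifunctions, the normals at the origin to the essential intersection
belong to the closed Aumann integral of the normal cones. -/
theorem limitingNormalCone_essInter_subset_of_isConeSet {μ : Measure Ω} [SigmaFinite μ]
    {M : Ω → Set (EuclideanSpace ℝ (Fin n))} (hM : MeasurableMultifunction M)
    (hc : ∀ ω, IsClosed (M ω)) (hx : 0 ∈ essInter μ M) (hcone : ∀ᵐ ω ∂μ, IsConeSet (M ω)) :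
    limitingNormalCone 0 (essInter μ M) ⊆
      closure (aumannIntegral μ fun ω => limitingNormalCone 0 (M ω)) := by
  rintro v ⟨-, y, w, -, -, hw, hwv⟩
  have hx' : ∀ᵐ ω ∂μ, 0 ∈ M ω := hx
  refine isClosed_closure.mem_of_tendsto hwv (Eventually.of_forall fun k => ?_)
  -- The target set does not depend on the base point `y k`, so each approximating regular normal
  -- lies in it and the limit stays in its closure; no regularity of the intersection is required.
  refine mem_closure_aumannIntegral hM hc
    (Eventually.of_forall fun ω c hc u hu => limitingNormalCone_smul hu hc) ?_ (hw k)
  filter_upwards [hx', hcone] with ω h0 hω y p hp hmin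
  rw [← contingentCone_zero_of_isConeSet (hc ω) hω] at hp hmin
  exact sub_mem_limitingNormalCone_of_nearest (hc ω) h0 hp hmin

end NormalCones

end VarAn

theorem theorem6p1 {Ω : Type*} [MeasurableSpace Ω] (μ : Measure Ω) [SigmaFinite μ]
    [μ.IsComplete] (hμ : 0 < μ Set.univ) (n : ℕ)
    (M : Ω → Set (EuclideanSpace ℝ (Fin n)))
    (hM : VarAn.MeasurableMultifunction M) (hMclosed : ∀ ω, IsClosed (M ω))
    (h : EuclideanSpace ℝ (Fin n) → EReal) (hbot : ∀ x, h x ≠ ⊥)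
    (xbar : EuclideanSpace ℝ (Fin n))
    (hlsc : ∀ᶠ x in 𝓝 xbar, LowerSemicontinuousAt h x)
    (hdom : h xbar ≠ ⊤)
    (hfeas : xbar ∈ VarAn.essInter μ M)
    (hmin : IsLocalMinOn h (VarAn.essInter μ M) xbar) :
    (VarAn.NormallyRegularAt (VarAn.essInter μ M) xbar →
      VarAn.MeasurableCHIP μ M xbar →
      (-VarAn.singularSubdifferential h xbar) ∩
        closure (VarAn.aumannIntegral μ (fun ω => VarAn.limitingNormalCone xbar (M ω))) = {0} →
      0 ∈ VarAn.basicSubdifferential h xbar +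
        closure (VarAn.aumannIntegral μ (fun ω => VarAn.limitingNormalCone xbar (M ω)))) ∧
    ((∀ᵐ ω ∂μ, VarAn.IsConeSet (M ω)) → xbar = 0 →
      (-VarAn.singularSubdifferential h xbar) ∩
        closure (VarAn.aumannIntegral μ (fun ω => VarAn.limitingNormalCone xbar (M ω))) = {0} →
      0 ∈ VarAn.basicSubdifferential h xbar +
        closure (VarAn.aumannIntegral μ (fun ω => VarAn.limitingNormalCone xbar (M ω)))) := by
  have hC := VarAn.isClosed_essInter (μ := μ) hMclosed
  refine ⟨fun hreg hchip hQ => ?_, fun hcone hx hQ => ?_⟩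
  · exact VarAn.zero_mem_basicSubdifferential_add hC hbot hlsc hdom hfeas hmin
      (VarAn.limitingNormalCone_essInter_subset_of_CHIP hM hMclosed hfeas hreg hchip) hQ
  · subst hx
    exact VarAn.zero_mem_basicSubdifferential_add hC hbot hlsc hdom hfeas hmin
      (VarAn.limitingNormalCone_essInter_subset_of_isConeSet hM hMclosed hfeas hcone) hQ
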